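/- Fix a countably infinite set of propositions. Formulas of classical modal logic $\mathsf{ML}$ are built from propositions with $\neg,\to,\Box$. Formulas of modal team logic $\mathsf{MTL}$ form the closure of $\mathsf{ML}$ under ${\sim}$, the material implication $\rightarrowtriangle$, the linear implication $\multimap$, $\Box$ and $\Delta$ (one symbol $\Box$: $\Box\alpha$ is an $\mathsf{ML}$ formula when $\alpha$ is). Abbreviate $\alpha\vee\beta:=\neg\alpha\to\beta$, $\varphi\otimes\psi:={\sim}(\varphi\multimap{\sim}\psi)$, $\Diamond\varphi:={\sim}\Delta{\sim}\varphi$, and let $\varphi\leftrightarrowtriangle\psi$ be the Boolean conjunction of $\varphi\rightarrowtriangle\psi$ and $\psi\rightarrowtriangle\varphi$, where the Boolean conjunction of $\varphi$ and $\psi$ is ${\sim}(\varphi\rightarrowtriangle{\sim}\psi)$. Formulas are evaluated in pairs $(K,T)$, where $K=(W,R,V)$ is a Kripke structure and $T\subseteq W$ is a (possibly empty) team. An $\mathsf{ML}$ formula holds in $(K,T)$ if it holds classically at every $w\in T$. $(K,T)\models{\sim}\varphi$ iff $(K,T)\not\models\varphi$; $(K,T)\models\varphi\rightarrowtriangle\psi$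 iff $(K,T)\not\models\varphi$ or $(K,T)\models\psi$; $(K,T)\models\varphi\multimap\psi$ iff for all $S,U$ with $S\cup U=T$, $(K,S)\models\varphi$ implies $(K,U)\models\psi$; $(K,T)\models\Box\varphi$ iff $(K,R[T])\models\varphi$, where $R[T]$ is the set of all successors of worlds of $T$; $(K,T)\models\Delta\varphi$ iff $(K,T')\models\varphi$ for every successor team $T'$ of $T$, i.e. every $T'$ such that each $w\in T$ has a successor in $T'$ and each $v\in T'$ has a predecessor in $T$. $\Phi\models\varphi$ means that every $(K,T)$ satisfying all of $\Phi$ satisfies $\varphi$. The proof system $\mathsf{H}^\Box\mathsf{LSM}$ has the following axioms, with $\alpha,\beta,\gamma$ ranging over $\mathsf{ML}$ formulas, $\varphi,\psi,\vartheta$ over $\mathsf{MTL}$ formulas, and implications associating to the right. - $\mathsf{H}^\Box$: $\alpha\to(\beta\to\alpha)$; $(\alpha\to(\beta\to\gamma))\to((\alpha\to\beta)\to(\alpha\to\gamma))$; $(\neg\alpha\to\neg\beta)\to(\beta\to\alpha)$; $\Box(\alpha\to\beta)\to(\Box\alpha\to\Box\beta)$. - $\mathsf{L}$: $\varphi\rightarrowtriangle(\psi\rightarrowtriangle\varphi)$;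 $(\varphi\rightarrowtriangle(\psi\rightarrowtriangle\vartheta))\rightarrowtriangle((\varphi\rightarrowtriangle\psi)\rightarrowtriangle(\varphi\rightarrowtriangle\vartheta))$; $({\sim}\varphi\rightarrowtriangle{\sim}\psi)\rightarrowtriangle(\psi\rightarrowtriangle\varphi)$; $(\alpha\to\beta)\rightarrowtriangle(\alpha\rightarrowtriangle\beta)$. - $\mathsf{S}$: $(\alpha\otimes\beta)\leftrightarrowtriangle(\alpha\vee\beta)$; $\alpha\rightarrowtriangle(\varphi\multimap\alpha)$; $\varphi\rightarrowtriangle(\varphi\multimap\psi)\rightarrowtriangle(\vartheta\multimap\psi)$; $(\varphi\multimap\psi\multimap\vartheta)\rightarrowtriangle(\psi\multimap\varphi\multimap\vartheta)$; $(\varphi\multimap{\sim}\psi)\rightarrowtriangle(\psi\multimap{\sim}\varphi)$; $(\varphi\multimap(\psi\rightarrowtriangle\vartheta))\rightarrowtriangle(\varphi\multimap\psi)\rightarrowtriangle(\varphi\multimap\vartheta)$. - $\mathsf{M}$: $\Box{\sim}\varphi\leftrightarrowtriangle{\sim}\Box\varphi$; $\Diamond\alpha\leftrightarrowtriangle\neg\Box\neg\alpha$;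 $\Diamond(\varphi\otimes\psi)\leftrightarrowtriangle(\Diamond\varphi\otimes\Diamond\psi)$; $\Box\alpha\rightarrowtriangle\Delta\alpha$; $\Diamond\varphi\rightarrowtriangle(\Delta\psi\rightarrowtriangle\Box\psi)$; $\Box(\varphi\rightarrowtriangle\psi)\rightarrowtriangle(\Box\varphi\rightarrowtriangle\Box\psi)$; $\Delta(\varphi\rightarrowtriangle\psi)\rightarrowtriangle(\Delta\varphi\rightarrowtriangle\Delta\psi)$. Its rules are modus ponens for $\to$ (on $\mathsf{ML}$ formulas) and for $\rightarrowtriangle$, and, applicable only if $\varphi$ is a theorem (derived without premises), the rules leading from $\varphi$ to $\psi\multimap\varphi$, to $\Box\varphi$ and to $\Delta\varphi$. Write $\Phi\vdash\varphi$ if $\varphi$ is derivable from the premises $\Phi$. **Theorem.** For every set $\Phi$ of $\mathsf{MTL}$ formulas and every $\mathsf{MTL}$ formula $\varphi$, $\Phi\vdash\varphi$ if and only if $\Phi\models\varphi$ (soundness and completeness). Moreover $\mathsf{MTL}$ is compact: if $\Phi\models\varphi$, then $\Phi_0\models\varphi$ for some finite $\Phi_0\subseteq\Phi$; and if every finite subset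 of $\Phi$ is satisfiable, then $\Phi$ is satisfiable. -/

import Mathlib

universe u

namespace MTL

/-! ## Syntax -/

/-- The two layers of formulas: formulas of classical modal logic `ML`, and the remaining formulas
of modal team logic, in which a team-logical operator occurs. -/
inductive Level where
  | classical
  | team

/-- Formulas of modal team logic, sorted by layer.  The propositions are indexed by `ℕ`.
`Fm .classical` is the set of `ML` formulas, the closure of the propositions under `¬`, `→`, `□`.
The operators `∼`, `⇝` (material implication), `⊸` and `Δ` apply to arbitrary formulas.  There is
only one symbol `□`: it applies to arbitrary formulas, and `□ α` is an `ML` formula if and only if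
`α` is one. -/
inductive Fm : Level → Type where
  | var : ℕ → Fm .classical
  | neg : Fm .classical → Fm .classical
  | imp : Fm .classical → Fm .classical → Fm .classical
  | box {l : Level} : Fm l → Fm l
  | snot {l : Level} : Fm l → Fm .team
  | mimp {l m : Level} : Fm l → Fm m → Fm .team
  | lin {l m : Level} : Fm l → Fm m → Fm .team
  | delta {l : Level} : Fm l → Fm .team

/-- Formulas of classical modal logic `ML`. -/
abbrev MLFormula : Type := Fm .classical

/-- All formulas of modal team logic `MTL`: those of `ML` and those of the team layer. -/
abbrev Formula : Type := Σ l : Level, Fm l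

prefix:75 "∼" => Fm.snot
infixr:60 " ⟶ₘ " => Fm.imp
infixr:55 " ⇝ " => Fm.mimp
infixr:60 " ⊸ₗ " => Fm.lin

namespace Fm

/-- Classical disjunction `α ∨ β := ¬ α → β`. -/
def or (α β : MLFormula) : MLFormula := neg α ⟶ₘ β

/-- Team-wide (Boolean) conjunction of two formulas, `∼(φ ⇝ ∼ψ)`. -/
def tand {l m : Level} (φ : Fm l) (ψ : Fm m) : Fm .team := ∼(φ ⇝ ∼ψ)

/-- Team-wide (Boolean) equivalence, `(φ ⇝ ψ)` and `(ψ ⇝ φ)`. -/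
def miff {l m : Level} (φ : Fm l) (ψ : Fm m) : Fm .team := tand (φ ⇝ ψ) (ψ ⇝ φ)

/-- Splitting disjunction `φ ⊗ ψ := ∼(φ ⊸ ∼ψ)`. -/
def tensor {l m : Level} (φ : Fm l) (ψ : Fm m) : Fm .team := ∼(φ ⊸ₗ ∼ψ)

/-- `◇ φ := ∼ Δ ∼ φ`. -/
def diamond {l : Level} (φ : Fm l) : Fm .team := ∼(delta (∼φ))

end Fm

/-! ## Semantics -/

/-- A Kripke structure `(W, R, V)`. -/
structure KripkeStructure where
  W : Type u
  R : W → W → Prop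
  V : ℕ → Set W

/-- Classical truth of an `ML` formula in a pointed Kripke structure `(K, w)`. -/
def PSat (K : KripkeStructure.{u}) : MLFormula → K.W → Prop
  | .var p, w => w ∈ K.V p
  | .neg α, w => ¬ PSat K α w
  | .imp α β, w => PSat K α w → PSat K β w
  | .box α, w => ∀ v, K.R w v → PSat K α v

/-- The global successor `R[T]` of a team `T`. -/
def KripkeStructure.succ (K : KripkeStructure.{u}) (T : Set K.W) : Set K.W :=
  {v | ∃ w ∈ T, K.R w v}

/-- `T'` is a successor team of `T`. -/
def KripkeStructure.IsSuccTeam (K : KripkeStructure.{u}) (T T' : Set K.W) : Prop :=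
  (∀ w ∈ T, ∃ v ∈ T', K.R w v) ∧ (∀ v ∈ T', ∃ w ∈ T, K.R w v)

/-- Truth of a formula in `(K, T)`, where `T` is a (possibly empty) team of worlds.  An `ML` formula
is true if it is classically true at all worlds of the team.  Splitting is lax. -/
def Sat (K : KripkeStructure.{u}) : {l : Level} → Fm l → Set K.W → Prop
  | .classical, α, T => ∀ w ∈ T, PSat K α w
  | .team, .box φ, T => Sat K φ (K.succ T)
  | .team, .snot φ, T => ¬ Sat K φ T
  | .team, .mimp φ ψ, T => Sat K φ T → Sat K ψ T
  | .team, .lin φ ψ, T => ∀ S U : Set K.W, S ∪ U = T → Sat K φ S → Sat K ψ U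
  | .team, .delta φ, T => ∀ T' : Set K.W, K.IsSuccTeam T T' → Sat K φ T'

/-- The team clause of `□` holds for `ML` formulas too, so the two readings of `□` agree. -/
theorem sat_box (K : KripkeStructure.{u}) {l : Level} (φ : Fm l) (T : Set K.W) :
    Sat K φ.box T ↔ Sat K φ (K.succ T) := by
  cases l with
  | team => simp only [Sat]
  | classical =>
    simp only [Sat, PSat, KripkeStructure.succ, Set.mem_ofPred_eq]
    exact ⟨fun h v ⟨w, hw, hv⟩ => h w hw v hv, fun h w hw v hv => h v ⟨w, hw, hv⟩⟩

/-- `(K, T)` satisfies every formula of `Φ`. -/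
def Models (K : KripkeStructure.{u}) (T : Set K.W) (Φ : Set Formula) : Prop :=
  ∀ φ ∈ Φ, Sat K φ.2 T

/-- Semantic entailment `Φ ⊨ φ` of modal team logic. -/
def Entails (Φ : Set Formula) (φ : Formula) : Prop :=
  ∀ (K : KripkeStructure.{u}) (T : Set K.W), Models K T Φ → Sat K φ.2 T

/-- `Φ` is true in some Kripke structure with some (possibly empty) team. -/
def Satisfiable (Φ : Set Formula) : Prop :=
  ∃ (K : KripkeStructure.{u}) (T : Set K.W), Models K T Φ

/-! ## The proof system `H^□ L S M` -/

open Fm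

/-- Axioms of the system `H^□` of classical modal logic. -/
inductive AxH : MLFormula → Prop where
  | A1 (α β : MLFormula) : AxH (α ⟶ₘ (β ⟶ₘ α))
  | A2 (α β γ : MLFormula) : AxH ((α ⟶ₘ (β ⟶ₘ γ)) ⟶ₘ ((α ⟶ₘ β) ⟶ₘ (α ⟶ₘ γ)))
  | A3 (α β : MLFormula) : AxH ((neg α ⟶ₘ neg β) ⟶ₘ (β ⟶ₘ α))
  | K (α β : MLFormula) : AxH (box (α ⟶ₘ β) ⟶ₘ (box α ⟶ₘ box β))

/-- Lifted propositional axioms, the system `L`. -/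
inductive AxL : Fm .team → Prop where
  | L1 {l m : Level} (φ : Fm l) (ψ : Fm m) : AxL (φ ⇝ (ψ ⇝ φ))
  | L2 {l m n : Level} (φ : Fm l) (ψ : Fm m) (θ : Fm n) :
      AxL ((φ ⇝ (ψ ⇝ θ)) ⇝ ((φ ⇝ ψ) ⇝ (φ ⇝ θ)))
  | L3 {l m : Level} (φ : Fm l) (ψ : Fm m) : AxL ((∼φ ⇝ ∼ψ) ⇝ (ψ ⇝ φ))
  | L4 (α β : MLFormula) : AxL ((α ⟶ₘ β) ⇝ (α ⇝ β))

/-- Splitting axioms, the system `S`. -/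
inductive AxS : Fm .team → Prop where
  | FTensor (α β : MLFormula) : AxS (miff (tensor α β) (Fm.or α β))
  | FLin {l : Level} (α : MLFormula) (φ : Fm l) : AxS (α ⇝ (φ ⊸ₗ α))
  | Lax {l m n : Level} (φ : Fm l) (ψ : Fm m) (θ : Fm n) :
      AxS (φ ⇝ ((φ ⊸ₗ ψ) ⇝ (θ ⊸ₗ ψ)))
  | ExLin {l m n : Level} (φ : Fm l) (ψ : Fm m) (θ : Fm n) :
      AxS ((φ ⊸ₗ (ψ ⊸ₗ θ)) ⇝ (ψ ⊸ₗ (φ ⊸ₗ θ)))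
  | CLin {l m : Level} (φ : Fm l) (ψ : Fm m) : AxS ((φ ⊸ₗ ∼ψ) ⇝ (ψ ⊸ₗ ∼φ))
  | DisLin {l m n : Level} (φ : Fm l) (ψ : Fm m) (θ : Fm n) :
      AxS ((φ ⊸ₗ (ψ ⇝ θ)) ⇝ ((φ ⊸ₗ ψ) ⇝ (φ ⊸ₗ θ)))

/-- Modal team axioms, the system `M`. -/
inductive AxM : Fm .team → Prop where
  | LinBox {l : Level} (φ : Fm l) : AxM (miff (box (∼φ)) (∼(box φ)))
  | FDiamond (α : MLFormula) : AxM (miff (diamond α) (neg (box (neg α))))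
  | DDiamondTensor {l m : Level} (φ : Fm l) (ψ : Fm m) :
      AxM (miff (diamond (tensor φ ψ)) (tensor (diamond φ) (diamond ψ)))
  | EBox (α : MLFormula) : AxM (box α ⇝ delta α)
  | IBox {l m : Level} (φ : Fm l) (ψ : Fm m) : AxM (diamond φ ⇝ (delta ψ ⇝ box ψ))
  | DisBox {l m : Level} (φ : Fm l) (ψ : Fm m) : AxM (box (φ ⇝ ψ) ⇝ (box φ ⇝ box ψ))
  | DisDelta {l m : Level} (φ : Fm l) (ψ : Fm m) :
      AxM (delta (φ ⇝ ψ) ⇝ (delta φ ⇝ delta ψ))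

/-- Derivability `Φ ⊢ φ` in `H^□ L S M`: the axioms above, the premises `Φ`, modus ponens for `→`
and for `⇝`, and the necessitation rules, which apply only to theorems, that is, to formulas derived
from no premises. -/
inductive Derives : Set Formula → {l : Level} → Fm l → Prop where
  | axH {Φ : Set Formula} {α : MLFormula} : AxH α → Derives Φ α
  | axL {Φ : Set Formula} {φ : Fm .team} : AxL φ → Derives Φ φ
  | axS {Φ : Set Formula} {φ : Fm .team} : AxS φ → Derives Φ φ
  | axM {Φ : Set Formula} {φ : Fm .team} : AxM φ → Derives Φ φ
  | prem {Φ : Set Formula} {l : Level} {φ : Fm l} : (⟨l, φ⟩ : Formula) ∈ Φ → Derives Φ φ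
  | mpImp {Φ : Set Formula} {α β : MLFormula} :
      Derives Φ α → Derives Φ (α ⟶ₘ β) → Derives Φ β
  | mpMimp {Φ : Set Formula} {l m : Level} {φ : Fm l} {ψ : Fm m} :
      Derives Φ φ → Derives Φ (φ ⇝ ψ) → Derives Φ ψ
  | necLin {Φ : Set Formula} {l m : Level} {φ : Fm l} (ψ : Fm m) :
      Derives ∅ φ → Derives Φ (ψ ⊸ₗ φ)
  -- for `ML` formulas this is also the necessitation rule of `H^□`
  | necBox {Φ : Set Formula} {l : Level} {φ : Fm l} : Derives ∅ φ → Derives Φ (box φ)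
  | necDelta {Φ : Set Formula} {l : Level} {φ : Fm l} : Derives ∅ φ → Derives Φ (delta φ)

end MTL

/-! Soundness is a routine induction on derivations. Completeness rests on one fact: a maximal
consistent set of team formulas is determined by the `ML` formulas it contains (`mlDetermined`).
Given such a set `Γ`, let the canonical team consist of all maximal consistent `ML` sets extending
the `ML` part of `Γ`. That part is closed under classical deduction, so the team satisfies exactly
the `ML` formulas of `Γ`. By soundness, the full theory of this team is itself a maximal consistent
set. It agrees with `Γ` on `ML`, hence everywhere, which is the truth lemma; the team operators
never have to be compared with their semantics. The fact is proved by induction on the formula, `⊸`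
and `Δ` being the hard cases. A formula determined by `ML` follows, inside any maximal consistent
set containing it, from a single basic formula "`α`, and none of the `βs`" in that set
(`exists_basic`, a compactness argument). For basic formulas, the axioms reduce `⊗` and `◇` to the
presence and absence of certain `ML` formulas. The difficult direction builds the required parts by
gluing small subteams together with lax splitting (`tensor_verum`). -/

namespace MTL

open Fm

/-! ## Lindenbaum's lemma for Hilbert systems -/

section Hilbert

variable {F : Type} (imp : F → F → F) (neg : F → F) (Thm : Set F)

/-- The closure of the theorems `Thm` and the premises `Φ` under modus ponens. -/
inductive MPClosure (Φ : Set F) : F → Prop where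
  | thm {φ : F} : φ ∈ Thm → MPClosure Φ φ
  | prem {φ : F} : φ ∈ Φ → MPClosure Φ φ
  | mp {φ ψ : F} : MPClosure Φ φ → MPClosure Φ (imp φ ψ) → MPClosure Φ ψ

/-- `Thm` contains Łukasiewicz's axioms and is closed under modus ponens. -/
structure IsClassical : Prop where
  a1 (φ ψ : F) : imp φ (imp ψ φ) ∈ Thm
  a2 (φ ψ θ : F) : imp (imp φ (imp ψ θ)) (imp (imp φ ψ) (imp φ θ)) ∈ Thm
  a3 (φ ψ : F) : imp (imp (neg φ) (neg ψ)) (imp ψ φ) ∈ Thm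
  mp {φ ψ : F} : φ ∈ Thm → imp φ ψ ∈ Thm → ψ ∈ Thm

/-- Maximal consistent sets. -/
structure IsMaxCons (Γ : Set F) : Prop where
  thm {φ : F} : φ ∈ Thm → φ ∈ Γ
  mp {φ ψ : F} : φ ∈ Γ → imp φ ψ ∈ Γ → ψ ∈ Γ
  neg_mem {φ : F} : neg φ ∈ Γ ↔ φ ∉ Γ

variable {imp neg Thm}

theorem MPClosure.mono {Φ Ψ : Set F} (h : Φ ⊆ Ψ) {φ : F} (hφ : MPClosure imp Thm Φ φ) :
    MPClosure imp Thm Ψ φ := by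
  induction hφ with
  | thm h' => exact .thm h'
  | prem h' => exact .prem (h h')
  | mp _ _ h₁ h₂ => exact .mp h₁ h₂

theorem MPClosure.exists_finite {Φ : Set F} {φ : F} (hφ : MPClosure imp Thm Φ φ) :
    ∃ Φ₀ ⊆ Φ, Φ₀.Finite ∧ MPClosure imp Thm Φ₀ φ := by
  induction hφ with
  | thm h => exact ⟨∅, Set.empty_subset _, Set.finite_empty, .thm h⟩
  | prem h =>
    exact ⟨{_}, Set.singleton_subset_iff.2 h, Set.finite_singleton _, .prem (Set.mem_singleton _)⟩
  | mp _ _ h₁ h₂ =>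
    obtain ⟨A, hA, fA, dA⟩ := h₁
    obtain ⟨B, hB, fB, dB⟩ := h₂
    exact ⟨A ∪ B, Set.union_subset hA hB, fA.union fB,
      .mp (dA.mono Set.subset_union_left) (dB.mono Set.subset_union_right)⟩

theorem MPClosure.thm_of_empty (hC : IsClassical imp neg Thm) {φ : F}
    (h : MPClosure imp Thm ∅ φ) : φ ∈ Thm := by
  induction h with
  | thm h => exact h
  | prem h => exact h.elim
  | mp _ _ h₁ h₂ => exact hC.mp h₁ h₂

namespace IsClassical

variable (hC : IsClassical imp neg Thm) {Φ : Set F} {φ ψ : F}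

include hC

theorem imp_self (φ : F) : imp φ φ ∈ Thm :=
  hC.mp (hC.a1 φ φ) (hC.mp (hC.a1 φ (imp φ φ)) (hC.a2 _ _ _))

theorem weaken (h : MPClosure imp Thm Φ φ) : MPClosure imp Thm Φ (imp ψ φ) :=
  .mp h (.thm (hC.a1 _ _))

theorem deduction (h : MPClosure imp Thm (insert φ Φ) ψ) : MPClosure imp Thm Φ (imp φ ψ) := by
  induction h with
  | thm h => exact hC.weaken (.thm h)
  | prem h =>
    rcases h with rfl | h
    · exact .thm (hC.imp_self _)
    · exact hC.weaken (.prem h)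
  | mp _ _ h₁ h₂ => exact .mp h₁ (.mp h₂ (.thm (hC.a2 _ _ _)))

theorem explosion (h : MPClosure imp Thm Φ φ) (h' : MPClosure imp Thm Φ (neg φ)) :
    MPClosure imp Thm Φ ψ :=
  .mp h (.mp (hC.weaken h') (.thm (hC.a3 _ _)))

/-- From `¬¬φ` comes `¬¬¬¬φ → ¬¬φ`; contraposing twice gives `¬φ → ¬¬¬φ` and then `¬¬φ → φ`. -/
theorem of_neg_neg (h : MPClosure imp Thm Φ (neg (neg φ))) : MPClosure imp Thm Φ φ :=
  .mp h (.mp (.mp (hC.weaken h) (.thm (hC.a3 (neg (neg (neg φ))) (neg φ)))) (.thm (hC.a3 _ _)))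

theorem by_contradiction (h : MPClosure imp Thm (insert (neg φ) Φ) φ) :
    MPClosure imp Thm Φ φ := by
  have h₁ : MPClosure imp Thm Φ (imp (neg φ) (neg (imp φ φ))) :=
    hC.deduction (hC.explosion h (.prem (Set.mem_insert _ _)))
  exact .mp (.thm (hC.imp_self φ)) (.mp h₁ (.thm (hC.a3 _ _)))

theorem cases_neg (h : MPClosure imp Thm (insert φ Φ) ψ)
    (h' : MPClosure imp Thm (insert (neg φ) Φ) ψ) : MPClosure imp Thm Φ ψ := by
  apply hC.by_contradiction
  have hn : MPClosure imp Thm (insert (neg ψ) Φ) (neg φ) := by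
    apply hC.by_contradiction
    have h₁ : MPClosure imp Thm (insert (neg (neg φ)) (insert (neg ψ) Φ)) φ :=
      hC.of_neg_neg (.prem (Set.mem_insert _ _))
    have h₂ : MPClosure imp Thm (insert (neg (neg φ)) (insert (neg ψ) Φ)) (imp φ ψ) :=
      (hC.deduction h).mono ((Set.subset_insert _ _).trans (Set.subset_insert _ _))
    exact hC.explosion (.mp h₁ h₂) (.prem (Set.mem_insert_of_mem _ (Set.mem_insert _ _)))
  exact .mp hn ((hC.deduction h').mono (Set.subset_insert _ _))

/-- **Lindenbaum's lemma.** -/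
theorem exists_isMaxCons (h : ¬ MPClosure imp Thm Φ φ) :
    ∃ Γ, Φ ⊆ Γ ∧ IsMaxCons imp neg Thm Γ ∧ φ ∉ Γ := by
  obtain ⟨Γ, hΦ, hΓ⟩ := zorn_subset_nonempty {Γ | ¬ MPClosure imp Thm Γ φ} (by
    intro c hc hchain hne
    refine ⟨⋃₀ c, fun hd => ?_, fun s hs => Set.subset_sUnion_of_mem hs⟩
    obtain ⟨Φ₀, hsub, hfin, hd⟩ := hd.exists_finite
    obtain ⟨s, hs, hs'⟩ := DirectedOn.exists_mem_subset_of_finite_of_subset_sUnion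
      hne hchain.directedOn hfin hsub
    exact hc hs (hd.mono hs')) Φ h
  have hcl {ψ : F} (hψ : MPClosure imp Thm Γ ψ) : ψ ∈ Γ := by
    by_contra hn
    have : MPClosure imp Thm (insert ψ Γ) φ := by
      by_contra hd
      exact hn (hΓ.2 hd (Set.subset_insert _ _) (Set.mem_insert _ _))
    exact hΓ.1 (.mp hψ (hC.deduction this))
  refine ⟨Γ, hΦ, ⟨fun h => hcl (.thm h), fun h h' => hcl (.mp (.prem h) (.prem h')), ?_⟩,
    fun hφ => hΓ.1 (.prem hφ)⟩
  intro ψ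
  constructor
  · intro h h'
    exact hΓ.1 (hC.explosion (.prem h') (.prem h))
  · intro hn
    by_contra hn'
    -- By maximality, adding any missing formula makes `φ` derivable; if both `ψ` and its negation
    -- were missing, `φ` would follow by cases.
    have aux {χ : F} (hχ : χ ∉ Γ) : MPClosure imp Thm (insert χ Γ) φ := by
      by_contra hd
      exact hχ (hΓ.2 hd (Set.subset_insert _ _) (Set.mem_insert _ _))
    exact hΓ.1 (hC.cases_neg (aux hn) (aux hn'))

theorem thm_of_forall (h : ∀ Γ, IsMaxCons imp neg Thm Γ → φ ∈ Γ) : φ ∈ Thm := by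
  by_contra hn
  obtain ⟨Γ, -, hΓ, hφ⟩ := hC.exists_isMaxCons (fun h => hn (MPClosure.thm_of_empty hC h))
  exact hφ (h Γ hΓ)

/-- The existence lemma for a normal operator `B`. -/
theorem exists_isMaxCons_of_normal {Γ : Set F} (B : F → F)
    (nec : ∀ φ ∈ Thm, B φ ∈ Γ) (dis : ∀ φ ψ, B (imp φ ψ) ∈ Γ → B φ ∈ Γ → B ψ ∈ Γ)
    {φ : F} (h : B φ ∉ Γ) :
    ∃ Δ, IsMaxCons imp neg Thm Δ ∧ φ ∉ Δ ∧ ∀ χ, B χ ∈ Γ → χ ∈ Δ := by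
  have hn : ¬ MPClosure imp Thm {χ | B χ ∈ Γ} φ := fun hd => h <| by
    clear h
    induction hd with
    | thm h => exact nec _ h
    | prem h => exact h
    | mp _ _ h₁ h₂ => exact dis _ _ h₂ h₁
  obtain ⟨Δ, hsub, hΔ, hφ⟩ := hC.exists_isMaxCons hn
  exact ⟨Δ, hΔ, hφ, fun χ hχ => hsub hχ⟩

end IsClassical

namespace IsMaxCons

variable {Γ : Set F} (hΓ : IsMaxCons imp neg Thm Γ)

include hΓ

theorem imp_mem (hC : IsClassical imp neg Thm) {φ ψ : F} :
    imp φ ψ ∈ Γ ↔ (φ ∈ Γ → ψ ∈ Γ) := by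
  refine ⟨fun h h' => hΓ.mp h' h, fun h => ?_⟩
  by_cases hφ : φ ∈ Γ
  · exact hΓ.mp (h hφ) (hΓ.thm (hC.a1 _ _))
  · exact hΓ.mp (hΓ.mp (hΓ.neg_mem.2 hφ) (hΓ.thm (hC.a1 _ _))) (hΓ.thm (hC.a3 ψ φ))

end IsMaxCons

end Hilbert

/-! ## Soundness -/

section Semantics

variable (K : KripkeStructure.{u}) {l m : Level} (T : Set K.W)

theorem sat_ml (α : MLFormula) : Sat K α T ↔ ∀ w ∈ T, PSat K α w := by
  simp only [Sat]

theorem sat_snot (φ : Fm l) : Sat K (∼φ) T ↔ ¬ Sat K φ T := by simp only [Sat]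

theorem sat_mimp (φ : Fm l) (ψ : Fm m) : Sat K (φ ⇝ ψ) T ↔ (Sat K φ T → Sat K ψ T) := by
  simp only [Sat]

theorem sat_lin (φ : Fm l) (ψ : Fm m) :
    Sat K (φ ⊸ₗ ψ) T ↔ ∀ S U : Set K.W, S ∪ U = T → Sat K φ S → Sat K ψ U := by
  simp only [Sat]

theorem sat_delta (φ : Fm l) :
    Sat K (delta φ) T ↔ ∀ T' : Set K.W, K.IsSuccTeam T T' → Sat K φ T' := by
  simp only [Sat]

theorem sat_miff (φ : Fm l) (ψ : Fm m) : Sat K (miff φ ψ) T ↔ (Sat K φ T ↔ Sat K ψ T) := by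
  simp only [miff, tand, sat_snot, sat_mimp]
  tauto

theorem sat_tensor (φ : Fm l) (ψ : Fm m) :
    Sat K (tensor φ ψ) T ↔ ∃ S U : Set K.W, S ∪ U = T ∧ Sat K φ S ∧ Sat K ψ U := by
  simp only [tensor, sat_snot, sat_lin]
  push Not
  rfl

theorem sat_diamond (φ : Fm l) :
    Sat K (diamond φ) T ↔ ∃ T' : Set K.W, K.IsSuccTeam T T' ∧ Sat K φ T' := by
  simp only [diamond, sat_snot, sat_delta]
  push Not
  rfl

variable {K T}

theorem Sat.mono {α : MLFormula} {S : Set K.W} (hST : S ⊆ T) (h : Sat K α T) : Sat K α S := by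
  rw [sat_ml] at h ⊢
  exact fun w hw => h w (hST hw)

theorem AxH.psat {α : MLFormula} (h : AxH α) (w : K.W) : PSat K α w := by
  cases h <;> simp only [PSat] <;> tauto

theorem AxL.sat {φ : Fm .team} (h : AxL φ) : Sat K φ T := by
  cases h with
  | L4 α β =>
    simp only [sat_mimp, sat_ml, PSat]
    exact fun h h' w hw => h w hw (h' w hw)
  | _ => simp only [sat_mimp, sat_snot]; tauto

theorem AxS.sat {φ : Fm .team} (h : AxS φ) : Sat K φ T := by
  cases h with
  | FTensor α β =>
    simp only [sat_miff, sat_tensor, sat_ml, Fm.or, PSat]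
    constructor
    · rintro ⟨S, U, rfl, hS, hU⟩ w (hw | hw) hn
      · exact (hn (hS w hw)).elim
      · exact hU w hw
    · intro h
      refine ⟨{w ∈ T | PSat K α w}, {w ∈ T | ¬ PSat K α w}, ?_, fun w hw => hw.2,
        fun w hw => h w hw.1 hw.2⟩
      ext w
      by_cases hw : PSat K α w <;> simp [hw]
  | FLin α φ =>
    simp only [sat_mimp, sat_lin]
    rintro h S U rfl -
    exact h.mono Set.subset_union_right
  | Lax φ ψ θ =>
    simp only [sat_mimp, sat_lin]
    rintro h h' S U rfl -
    -- Parts may overlap, so the whole team can serve as the left part.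
    exact h' (S ∪ U) U (by simp) h
  | ExLin φ ψ θ =>
    simp only [sat_mimp, sat_lin]
    rintro h A _ rfl hA B C rfl hB
    exact h B (A ∪ C) (Set.union_left_comm _ _ _) hB A C rfl hA
  | CLin φ ψ =>
    simp only [sat_mimp, sat_lin, sat_snot]
    exact fun h S U hT hS hU => h U S (Set.union_comm _ _ ▸ hT) hU hS
  | DisLin φ ψ θ =>
    simp only [sat_mimp, sat_lin]
    exact fun h h' S U hT hS => h S U hT hS (h' S U hT hS)

theorem AxM.sat {φ : Fm .team} (h : AxM φ) : Sat K φ T := by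
  cases h with
  | LinBox φ => simp only [sat_miff, sat_box, sat_snot]
  | FDiamond α =>
    simp only [sat_miff, sat_diamond, sat_ml, PSat]
    constructor
    · rintro ⟨T', ⟨h, -⟩, h'⟩ w hw hn
      obtain ⟨v, hv, hR⟩ := h w hw
      exact hn v hR (h' v hv)
    · intro h
      refine ⟨{v | PSat K α v ∧ ∃ w ∈ T, K.R w v}, ⟨fun w hw => ?_, fun v hv => hv.2⟩,
        fun v hv => hv.1⟩
      have := h w hw
      push Not at this
      obtain ⟨v, hR, hv⟩ := this
      exact ⟨v, ⟨hv, w, hw, hR⟩, hR⟩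
  | DDiamondTensor φ ψ =>
    simp only [sat_miff, sat_diamond, sat_tensor]
    constructor
    · rintro ⟨_, ⟨h, h'⟩, S, U, rfl, hS, hU⟩
      -- A split of the successor team is pulled back to the worlds that see each part; these may
      -- overlap.
      refine ⟨{w ∈ T | ∃ v ∈ S, K.R w v}, {w ∈ T | ∃ v ∈ U, K.R w v}, ?_,
        ⟨S, ⟨fun w hw => hw.2, fun v hv => ?_⟩, hS⟩, ⟨U, ⟨fun w hw => hw.2, fun v hv => ?_⟩, hU⟩⟩
      · ext w
        constructor
        · rintro (hw | hw) <;> exact hw.1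
        · intro hw
          obtain ⟨v, hv | hv, hR⟩ := h w hw
          exacts [Or.inl ⟨hw, v, hv, hR⟩, Or.inr ⟨hw, v, hv, hR⟩]
      · obtain ⟨w, hw, hR⟩ := h' v (Or.inl hv)
        exact ⟨w, ⟨hw, v, hv, hR⟩, hR⟩
      · obtain ⟨w, hw, hR⟩ := h' v (Or.inr hv)
        exact ⟨w, ⟨hw, v, hv, hR⟩, hR⟩
    · rintro ⟨S, U, rfl, ⟨S', ⟨h₁, h₂⟩, hS⟩, U', ⟨h₃, h₄⟩, hU⟩
      refine ⟨S' ∪ U', ⟨?_, ?_⟩, S', U', rfl, hS, hU⟩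
      · rintro w (hw | hw)
        · obtain ⟨v, hv, hR⟩ := h₁ w hw
          exact ⟨v, Or.inl hv, hR⟩
        · obtain ⟨v, hv, hR⟩ := h₃ w hw
          exact ⟨v, Or.inr hv, hR⟩
      · rintro v (hv | hv)
        · obtain ⟨w, hw, hR⟩ := h₂ v hv
          exact ⟨w, Or.inl hw, hR⟩
        · obtain ⟨w, hw, hR⟩ := h₄ v hv
          exact ⟨w, Or.inr hw, hR⟩
  | EBox α =>
    simp only [sat_mimp, sat_delta, sat_box]
    exact fun h T' hT' => h.mono hT'.2
  | IBox φ ψ =>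
    simp only [sat_mimp, sat_delta, sat_box, sat_diamond]
    rintro ⟨T', hT', -⟩ h
    -- Once some successor team exists, every world of `T` has a successor, so `R[T]` is itself a
    -- successor team.
    refine h _ ⟨fun w hw => ?_, fun v hv => hv⟩
    obtain ⟨v, -, hR⟩ := hT'.1 w hw
    exact ⟨v, ⟨w, hw, hR⟩, hR⟩
  | DisBox φ ψ =>
    simp only [sat_mimp, sat_box]
    exact fun h => h
  | DisDelta φ ψ =>
    simp only [sat_mimp, sat_delta]
    exact fun h h' T' hT' => h T' hT' (h' T' hT')

/-- The team is generalised in the induction because a necessitation rule uses its premise, a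
theorem, in a different team. -/
theorem Derives.sound {Φ : Set Formula} {φ : Fm l} (h : Derives Φ φ) (hT : Models K T Φ) :
    Sat K φ T := by
  induction h generalizing T with
  | axH h => exact (sat_ml K T _).2 fun w _ => h.psat w
  | axL h => exact h.sat
  | axS h => exact h.sat
  | axM h => exact h.sat
  | prem h => exact hT _ h
  | mpImp _ _ h₁ h₂ =>
    simp only [sat_ml, PSat] at h₁ h₂ ⊢
    exact fun w hw => h₂ hT w hw (h₁ hT w hw)
  | mpMimp _ _ h₁ h₂ => exact (sat_mimp K T _ _).1 (h₂ hT) (h₁ hT)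
  | necLin ψ _ h =>
    rw [sat_lin]
    exact fun S U _ _ => h fun _ hφ => hφ.elim
  | necBox _ h =>
    rw [sat_box]
    exact h fun _ hφ => hφ.elim
  | necDelta _ h =>
    rw [sat_delta]
    exact fun T' _ => h fun _ hφ => hφ.elim

end Semantics

/-! ## Maximal consistent sets of modal team logic -/

/-- The theorems among the `ML` formulas. -/
def mlThm : Set MLFormula := {α | Derives ∅ α}

/-- The theorems among all formulas. -/
def teamThm : Set Formula := {φ | Derives ∅ φ.2}

/-- Material implication on the type of all formulas. -/
def formulaImp (φ ψ : Formula) : Formula := ⟨.team, φ.2 ⇝ ψ.2⟩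

/-- Strong negation on the type of all formulas. -/
def formulaNeg (φ : Formula) : Formula := ⟨.team, ∼φ.2⟩

theorem isClassical_ml : IsClassical Fm.imp Fm.neg mlThm where
  a1 _ _ := .axH (.A1 _ _)
  a2 _ _ _ := .axH (.A2 _ _ _)
  a3 _ _ := .axH (.A3 _ _)
  mp h h' := .mpImp h h'

theorem isClassical_team : IsClassical formulaImp formulaNeg teamThm where
  a1 _ _ := .axL (.L1 _ _)
  a2 _ _ _ := .axL (.L2 _ _ _)
  a3 _ _ := .axL (.L3 _ _)
  mp h h' := .mpMimp h h'

/-- Maximal consistent sets of `ML` formulas: the worlds of the canonical structure. -/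
abbrev IsWorld (w : Set MLFormula) : Prop := IsMaxCons Fm.imp Fm.neg mlThm w

/-- Maximal consistent sets of formulas of modal team logic. -/
abbrev IsMCS (Γ : Set Formula) : Prop := IsMaxCons formulaImp formulaNeg teamThm Γ

/-- Membership of a formula in a set of formulas of both layers. -/
abbrev Has (Γ : Set Formula) {l : Level} (φ : Fm l) : Prop := (⟨l, φ⟩ : Formula) ∈ Γ

theorem Derives.mono {Φ Ψ : Set Formula} (h : Φ ⊆ Ψ) {l : Level} {φ : Fm l}
    (hφ : Derives Φ φ) : Derives Ψ φ := by
  induction hφ with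
  | axH h' => exact .axH h'
  | axL h' => exact .axL h'
  | axS h' => exact .axS h'
  | axM h' => exact .axM h'
  | prem h' => exact .prem (h h')
  | mpImp _ _ h₁ h₂ => exact .mpImp (h₁ h) (h₂ h)
  | mpMimp _ _ h₁ h₂ => exact .mpMimp (h₁ h) (h₂ h)
  | necLin ψ h' => exact .necLin ψ h'
  | necBox h' => exact .necBox h'
  | necDelta h' => exact .necDelta h'

theorem derives_of_closure {Φ : Set Formula} {φ : Formula}
    (h : MPClosure formulaImp teamThm Φ φ) : Derives Φ φ.2 := by
  induction h with
  | thm h => exact Derives.mono (Set.empty_subset _) h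
  | prem h => exact .prem h
  | mp _ _ h₁ h₂ => exact .mpMimp h₁ h₂

/-- A formula that belongs to all maximal consistent sets is a theorem. -/
theorem derives_of_forall {l : Level} {φ : Fm l} (h : ∀ Γ, IsMCS Γ → Has Γ φ) : Derives ∅ φ :=
  isClassical_team.thm_of_forall (φ := ⟨l, φ⟩) h

theorem ml_derives_of_forall {α : MLFormula} (h : ∀ w, IsWorld w → α ∈ w) : Derives ∅ α :=
  isClassical_ml.thm_of_forall h

/-- A verum. -/
def verum : MLFormula := var 0 ⟶ₘ var 0

theorem derives_verum : Derives ∅ verum := isClassical_ml.imp_self _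

/-- Classical conjunction. -/
def mand (α β : MLFormula) : MLFormula := neg (α ⟶ₘ neg β)

namespace IsMaxCons

section

variable {Γ : Set Formula} (hΓ : IsMCS Γ) {l m n : Level}
  {φ : Fm l} {ψ : Fm m} {θ : Fm n} {α β : MLFormula}

include hΓ

theorem has (h : Derives ∅ φ) : Has Γ φ := hΓ.thm (φ := ⟨l, φ⟩) h

theorem has_mp (h : Has Γ (φ ⇝ ψ)) (h' : Has Γ φ) : Has Γ ψ :=
  hΓ.mp (φ := ⟨l, φ⟩) (ψ := ⟨m, ψ⟩) h' h

theorem has_snot : Has Γ (∼φ) ↔ ¬ Has Γ φ := hΓ.neg_mem (φ := ⟨l, φ⟩)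

theorem has_mimp : Has Γ (φ ⇝ ψ) ↔ (Has Γ φ → Has Γ ψ) :=
  hΓ.imp_mem isClassical_team (φ := ⟨l, φ⟩) (ψ := ⟨m, ψ⟩)

theorem has_tand : Has Γ (tand φ ψ) ↔ Has Γ φ ∧ Has Γ ψ := by
  simp only [tand, hΓ.has_snot, hΓ.has_mimp]
  tauto

theorem has_miff : Has Γ (miff φ ψ) ↔ (Has Γ φ ↔ Has Γ ψ) := by
  simp only [miff, hΓ.has_tand, hΓ.has_mimp]
  tauto

theorem has_mp_ml (h : Has Γ (α ⟶ₘ β)) (h' : Has Γ α) : Has Γ β :=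
  hΓ.has_mp (hΓ.has_mp (hΓ.has (.axL (.L4 α β))) h) h'

/-- Classical reasoning inside `Γ` can be checked world by world. This is needed because the `ML`
part of `Γ` is only a deductively closed theory: absence of `α` does not give `¬α`. -/
theorem has_of_imp (h : ∀ w, IsWorld w → α ∈ w → β ∈ w) (h' : Has Γ α) : Has Γ β :=
  hΓ.has_mp_ml (hΓ.has (ml_derives_of_forall fun w hw => (hw.imp_mem isClassical_ml).2 (h w hw))) h'

theorem has_mand : Has Γ (mand α β) ↔ Has Γ α ∧ Has Γ β := by
  have key (w) (hw : IsWorld w) : mand α β ∈ w ↔ α ∈ w ∧ β ∈ w := by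
    simp only [mand, hw.neg_mem, hw.imp_mem isClassical_ml]
    tauto
  refine ⟨fun h => ⟨hΓ.has_of_imp (fun w hw hm => ((key w hw).1 hm).1) h,
    hΓ.has_of_imp (fun w hw hm => ((key w hw).1 hm).2) h⟩, fun ⟨h, h'⟩ => ?_⟩
  refine hΓ.has_mp_ml (hΓ.has_of_imp (fun w hw hm => ?_) h) h'
  rw [hw.imp_mem isClassical_ml, key w hw]
  exact fun h => ⟨hm, h⟩

/-! ### Splitting -/

theorem has_tensor : Has Γ (tensor φ ψ) ↔ ¬ Has Γ (φ ⊸ₗ ∼ψ) := hΓ.has_snot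

/-- `φ ⊸ₗ ·` is a normal operator, by `necLin` and `DisLin`. The hypothesis over all maximal
consistent sets expresses that `ψ ⇝ θ` is a theorem. -/
theorem has_lin_mono (h : ∀ Δ, IsMCS Δ → Has Δ ψ → Has Δ θ) (h' : Has Γ (φ ⊸ₗ ψ)) :
    Has Γ (φ ⊸ₗ θ) :=
  hΓ.has_mp (hΓ.has_mp (hΓ.has (.axS (.DisLin φ ψ θ)))
    (hΓ.has (.necLin φ (derives_of_forall fun Δ hΔ => hΔ.has_mimp.2 (h Δ hΔ))))) h'

theorem tensor_mono_right (h : ∀ Δ, IsMCS Δ → Has Δ ψ → Has Δ θ) (h' : Has Γ (tensor φ ψ)) :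
    Has Γ (tensor φ θ) := by
  rw [hΓ.has_tensor] at h' ⊢
  refine fun hn => h' (hΓ.has_lin_mono (fun Δ hΔ => ?_) hn)
  rw [hΔ.has_snot, hΔ.has_snot]
  exact mt (h Δ hΔ)

theorem tensor_comm (h : Has Γ (tensor φ ψ)) : Has Γ (tensor ψ φ) := by
  rw [hΓ.has_tensor] at h ⊢
  exact fun hn => h (hΓ.has_mp (hΓ.has (.axS (.CLin ψ φ))) hn)

theorem tensor_mono_left (h : ∀ Δ, IsMCS Δ → Has Δ ψ → Has Δ θ) (h' : Has Γ (tensor ψ φ)) :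
    Has Γ (tensor θ φ) :=
  hΓ.tensor_comm (hΓ.tensor_mono_right h (hΓ.tensor_comm h'))

theorem tensor_left_comm (h : Has Γ (tensor φ (tensor ψ θ))) :
    Has Γ (tensor ψ (tensor φ θ)) := by
  rw [hΓ.has_tensor] at h ⊢
  refine fun hn => h ?_
  have h₁ : Has Γ (ψ ⊸ₗ (φ ⊸ₗ ∼θ)) := hΓ.has_lin_mono (fun Δ hΔ hΔ' => by
    rw [hΔ.has_snot, hΔ.has_tensor] at hΔ'
    exact not_not.1 hΔ') hn
  refine hΓ.has_lin_mono (fun Δ hΔ hΔ' => ?_) (hΓ.has_mp (hΓ.has (.axS (.ExLin ψ φ (∼θ)))) h₁)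
  rw [hΔ.has_snot, hΔ.has_tensor]
  exact not_not.2 hΔ'

theorem tensor_assoc (h : Has Γ (tensor φ (tensor ψ θ))) : Has Γ (tensor (tensor φ ψ) θ) :=
  hΓ.tensor_comm (hΓ.tensor_left_comm (hΓ.tensor_mono_right (fun _ hΔ => hΔ.tensor_comm) h))

/-- If `φ` holds in the whole team, the left part can be enlarged to the whole team. -/
theorem tensor_lax (h : Has Γ φ) (h' : Has Γ (tensor θ ψ)) : Has Γ (tensor φ ψ) := by
  rw [hΓ.has_tensor] at h' ⊢
  exact fun hn => h' (hΓ.has_mp (hΓ.has_mp (hΓ.has (.axS (.Lax φ (∼ψ) θ))) h) hn)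

theorem has_tensor_ml : Has Γ (tensor α β) ↔ Has Γ (Fm.or α β) :=
  hΓ.has_miff.1 (hΓ.has (.axS (.FTensor α β)))

/-- The existence lemma for the normal operator `φ ⊸ₗ ·`: `Δ` plays the theory of a right part whose
complementary left part satisfies `φ`. -/
theorem exists_of_tensor (h : Has Γ (tensor φ ψ)) :
    ∃ Δ, IsMCS Δ ∧ Has Δ ψ ∧ ∀ {k : Level} (χ : Fm k), Has Δ χ → Has Γ (tensor φ χ) := by
  obtain ⟨Δ, hΔ, hψ, hall⟩ := isClassical_team.exists_isMaxCons_of_normal (Γ := Γ)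
    (fun χ => ⟨.team, φ ⊸ₗ χ.2⟩) (fun χ hχ => hΓ.has (.necLin φ hχ))
    (fun χ χ' h => hΓ.has_mp (hΓ.has_mp (hΓ.has (.axS (.DisLin φ χ.2 χ'.2))) h))
    (φ := ⟨.team, ∼ψ⟩) (hΓ.has_tensor.1 h)
  refine ⟨Δ, hΔ, not_not.1 (mt hΔ.has_snot.2 hψ), fun χ hχ => hΓ.has_tensor.2 fun hn => ?_⟩
  exact hΔ.has_snot.1 (hall ⟨.team, ∼χ⟩ hn) hχ

/-! ### Modalities -/

theorem has_diamond : Has Γ (diamond φ) ↔ ¬ Has Γ (delta (∼φ)) := hΓ.has_snot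

theorem has_delta_mono (h : ∀ Δ, IsMCS Δ → Has Δ ψ → Has Δ θ) (h' : Has Γ (delta ψ)) :
    Has Γ (delta θ) :=
  hΓ.has_mp (hΓ.has_mp (hΓ.has (.axM (.DisDelta ψ θ)))
    (hΓ.has (.necDelta (derives_of_forall fun Δ hΔ => hΔ.has_mimp.2 (h Δ hΔ))))) h'

theorem diamond_mono (h : ∀ Δ, IsMCS Δ → Has Δ ψ → Has Δ θ) (h' : Has Γ (diamond ψ)) :
    Has Γ (diamond θ) := by
  rw [hΓ.has_diamond] at h' ⊢
  refine fun hn => h' (hΓ.has_delta_mono (fun Δ hΔ => ?_) hn)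
  rw [hΔ.has_snot, hΔ.has_snot]
  exact mt (h Δ hΔ)

theorem has_diamond_ml : Has Γ (diamond α) ↔ Has Γ (neg (box (neg α))) :=
  hΓ.has_miff.1 (hΓ.has (.axM (.FDiamond α)))

theorem diamond_tensor :
    Has Γ (diamond (tensor φ ψ)) ↔ Has Γ (tensor (diamond φ) (diamond ψ)) :=
  hΓ.has_miff.1 (hΓ.has (.axM (.DDiamondTensor φ ψ)))

theorem has_box_snot : Has Γ (box (∼φ)) ↔ ¬ Has Γ (box φ) :=
  (hΓ.has_miff.1 (hΓ.has (.axM (.LinBox φ)))).trans hΓ.has_snot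

/-- By `IBox`, the global successor is a successor team as soon as some successor team exists. -/
theorem diamond_of_box (h : Has Γ (diamond φ)) (h' : Has Γ (box ψ)) : Has Γ (diamond ψ) := by
  rw [hΓ.has_diamond (φ := ψ)]
  exact fun hn => hΓ.has_box_snot.1
    (hΓ.has_mp (hΓ.has_mp (hΓ.has (.axM (.IBox φ (∼ψ)))) h) hn) h'

theorem exists_of_not_delta (h : ¬ Has Γ (delta φ)) :
    ∃ Δ, IsMCS Δ ∧ ¬ Has Δ φ ∧ ∀ {k : Level} (χ : Fm k), Has Γ (delta χ) → Has Δ χ := by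
  obtain ⟨Δ, hΔ, hψ, hall⟩ := isClassical_team.exists_isMaxCons_of_normal (Γ := Γ)
    (fun χ => ⟨.team, delta χ.2⟩) (fun χ hχ => hΓ.has (.necDelta hχ))
    (fun χ χ' h => hΓ.has_mp (hΓ.has_mp (hΓ.has (.axM (.DisDelta χ.2 χ'.2))) h))
    (φ := ⟨l, φ⟩) h
  exact ⟨Δ, hΔ, hψ, fun {k} χ hχ => hall ⟨k, χ⟩ hχ⟩

/-- The maximal consistent set of the global successor. -/
theorem preimage_box : IsMCS {φ : Formula | Has Γ (box φ.2)} where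
  thm h := hΓ.has (.necBox h)
  mp {φ ψ} h h' := hΓ.has_mp (hΓ.has_mp (hΓ.has (.axM (.DisBox φ.2 ψ.2))) h') h
  neg_mem := hΓ.has_box_snot

end

end IsMaxCons

/-! ## Basic formulas -/

/-- `α` together with the strong negations of the formulas `βs`. -/
def basic (α : MLFormula) : List MLFormula → Fm .team
  -- The double strong negation only moves `α` to the team layer.
  | [] => ∼∼α
  | β :: βs => tand (∼β) (basic α βs)

namespace IsMaxCons

section

variable {Γ : Set Formula} (hΓ : IsMCS Γ) {l : Level} {φ : Fm l} {α β γ : MLFormula}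
  {βs γs : List MLFormula}

include hΓ

theorem has_basic : Has Γ (basic α βs) ↔ Has Γ α ∧ ∀ β ∈ βs, ¬ Has Γ β := by
  induction βs with
  | nil => simp [basic, hΓ.has_snot]
  | cons β βs ih =>
    simp only [basic, hΓ.has_tand, hΓ.has_snot, ih, List.forall_mem_cons]
    tauto

/-- `ML` formulas are inherited by the parts of a split. -/
theorem not_has_of_tensor (h : Has Γ (tensor φ (basic α βs))) (hβ : β ∈ βs) :
    ¬ Has Γ (α ⟶ₘ β) := by
  intro hn
  refine hΓ.has_tensor.1 h (hΓ.has_lin_mono (fun Δ hΔ hi => ?_)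
    (hΓ.has_mp (hΓ.has (.axS (.FLin (α ⟶ₘ β) φ))) hn))
  rw [hΔ.has_snot, hΔ.has_basic]
  exact fun ⟨ha, hb⟩ => hb β hβ (hΔ.has_mp_ml hi ha)

theorem has_imp_of_has (h : Has Γ β) : Has Γ (α ⟶ₘ β) :=
  hΓ.has_mp_ml (hΓ.has (.axH (.A1 β α))) h

/-- The tensor of two basic formulas, in terms of `ML` formulas. -/
theorem tensor_basic_left (h : Has Γ (tensor (basic α βs) (basic γ γs))) :
    Has Γ (Fm.or α γ) ∧ (∀ β ∈ βs, ¬ Has Γ (α ⟶ₘ β)) ∧ ∀ β ∈ γs, ¬ Has Γ (γ ⟶ₘ β) :=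
  ⟨hΓ.has_tensor_ml.1 (hΓ.tensor_mono_left (fun _ hΔ hb => (hΔ.has_basic.1 hb).1)
      (hΓ.tensor_mono_right (fun _ hΔ hb => (hΔ.has_basic.1 hb).1) h)),
    fun _ hβ => hΓ.not_has_of_tensor (hΓ.tensor_comm h) hβ,
    fun _ hβ => hΓ.not_has_of_tensor h hβ⟩

/-- A union of teams satisfying `α` satisfies `α`, and a formula refuted in a part is refuted in the
union. -/
theorem basic_append (h : Has Γ (tensor (basic α βs) (basic α γs))) :
    Has Γ (basic α (βs ++ γs)) := by
  obtain ⟨h₁, h₂, h₃⟩ := hΓ.tensor_basic_left h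
  refine hΓ.has_basic.2 ⟨hΓ.has_of_imp (fun w hw hm => ?_) h₁, fun β hβ => ?_⟩
  · simp only [Fm.or, hw.imp_mem isClassical_ml, hw.neg_mem] at hm
    tauto
  · rcases List.mem_append.1 hβ with hβ | hβ
    · exact fun hn => h₂ β hβ (hΓ.has_imp_of_has hn)
    · exact fun hn => h₃ β hβ (hΓ.has_imp_of_has hn)

/-- Some subteam satisfies `α` and refutes every `β` in the list. For one `β`, the `α`-part of the
split into `¬α` and `α` refutes it, since otherwise `α ⟶ₘ β` would hold. Laxness and `basic_append`
merge the subteams obtained for the various `β`. -/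
theorem tensor_verum (h : ∀ β ∈ βs, ¬ Has Γ (α ⟶ₘ β)) :
    Has Γ (tensor (basic α βs) verum) := by
  have h₀ : Has Γ (tensor (neg α) α) :=
    hΓ.tensor_comm (hΓ.has_tensor_ml.2 (hΓ.has (isClassical_ml.imp_self (neg α))))
  induction βs with
  | nil =>
    refine hΓ.tensor_mono_left (fun Δ hΔ ha => hΔ.has_basic.2 ⟨ha, by simp⟩)
      (hΓ.tensor_mono_right (fun Δ hΔ _ => hΔ.has derives_verum) (hΓ.tensor_comm h₀))
  | cons β βs ih =>
    rw [List.forall_mem_cons] at h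
    obtain ⟨Δ, hΔ, hα, hall⟩ := hΓ.exists_of_tensor h₀
    have hβ : ¬ Has Δ β := fun hβ => h.1 <|
      hΓ.has_mp_ml (hΓ.has (.axH (.A3 β α))) (hΓ.has_tensor_ml.1 (hΓ.tensor_comm (hall β hβ)))
    have h₁ : Has Γ (tensor verum (basic α [β])) :=
      hΓ.tensor_mono_left (fun Δ hΔ _ => hΔ.has derives_verum)
        (hall _ (hΔ.has_basic.2 ⟨hα, by simpa using hβ⟩))
    exact hΓ.tensor_mono_left (fun Δ hΔ => hΔ.basic_append)
      (hΓ.tensor_assoc (hΓ.tensor_comm (hΓ.tensor_lax (ih h.2) h₁)))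

/-- Start from the flat split into `α` and `γ`. Each part may be enlarged, by laxness, with the
subteam from `tensor_verum` that refutes the required formulas, and it absorbs that subteam. -/
theorem tensor_basic_right (h : Has Γ (Fm.or α γ)) (hβ : ∀ β ∈ βs, ¬ Has Γ (α ⟶ₘ β))
    (hγ : ∀ β ∈ γs, ¬ Has Γ (γ ⟶ₘ β)) : Has Γ (tensor (basic α βs) (basic γ γs)) := by
  have absorb {δ : MLFormula} {δs : List MLFormula} {Δ : Set Formula} (hΔ : IsMCS Δ)
      (h : Has Δ (tensor (basic δ δs) δ)) : Has Δ (basic δ δs) := by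
    have := hΔ.basic_append
      (hΔ.tensor_mono_right (fun Θ hΘ hδ => hΘ.has_basic (βs := []).2 ⟨hδ, by simp⟩) h)
    rwa [List.append_nil] at this
  have extend {δ : MLFormula} {δs : List MLFormula} {l : Level} {φ : Fm l}
      (h : Has Γ (tensor δ φ)) (hδ : ∀ β ∈ δs, ¬ Has Γ (δ ⟶ₘ β)) :
      Has Γ (tensor (basic δ δs) φ) :=
    hΓ.tensor_mono_left (fun Δ hΔ => absorb hΔ) (hΓ.tensor_assoc
      (hΓ.tensor_comm (hΓ.tensor_lax h (hΓ.tensor_comm (hΓ.tensor_verum hδ)))))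
  exact extend (hΓ.tensor_comm (extend (hΓ.tensor_comm (hΓ.has_tensor_ml.2 h)) hγ)) hβ

theorem diamond_basic_left (h : Has Γ (diamond (basic α βs))) :
    Has Γ (neg (box (neg α))) ∧ ∀ β ∈ βs, ¬ Has Γ (box (α ⟶ₘ β)) := by
  refine ⟨hΓ.has_diamond_ml.1 (hΓ.diamond_mono (fun _ hΔ hb => (hΔ.has_basic.1 hb).1) h),
    fun β hβ hn => hΓ.has_diamond.1 h ?_⟩
  refine hΓ.has_delta_mono (fun Δ hΔ hi => ?_) (hΓ.has_mp (hΓ.has (.axM (.EBox (α ⟶ₘ β)))) hn)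
  rw [hΔ.has_snot, hΔ.has_basic]
  exact fun ⟨ha, hb⟩ => hb β hβ (hΔ.has_mp_ml hi ha)

/-- `tensor_verum` applied to the global successor gives a team with the required refutations, but
it is a successor team of only a part of the current team. Its union with a successor team of the
whole satisfying `α` repairs this. -/
theorem diamond_basic_right (h : Has Γ (neg (box (neg α))))
    (hβ : ∀ β ∈ βs, ¬ Has Γ (box (α ⟶ₘ β))) : Has Γ (diamond (basic α βs)) := by
  have hα := hΓ.has_diamond_ml.2 h
  have h₁ : Has Γ (box (tensor (basic α βs) verum)) :=
    hΓ.preimage_box.tensor_verum (α := α) (βs := βs) hβ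
  have h₂ := hΓ.diamond_tensor.1 (hΓ.diamond_of_box hα h₁)
  have h₃ := hΓ.diamond_tensor.2 (hΓ.tensor_lax hα (hΓ.tensor_comm h₂))
  refine hΓ.diamond_mono (fun Δ hΔ hb => ?_) h₃
  have := hΔ.basic_append (βs := [])
    (hΔ.tensor_mono_left (fun Θ hΘ hδ => hΘ.has_basic.2 ⟨hδ, by simp⟩) hb)
  rwa [List.nil_append] at this

end

end IsMaxCons

/-! ## Maximal consistent sets are determined by their `ML` formulas -/

/-- Membership of `φ` in a maximal consistent set depends on its `ML` formulas only. -/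
def MLDetermined {l : Level} (φ : Fm l) : Prop :=
  ∀ Γ Δ, IsMCS Γ → IsMCS Δ → (∀ α : MLFormula, Has Γ α ↔ Has Δ α) → (Has Γ φ ↔ Has Δ φ)

theorem MLDetermined.snot {l : Level} {φ : Fm l} (h : MLDetermined φ) : MLDetermined (∼φ) :=
  fun Γ Δ hΓ hΔ hα => by rw [hΓ.has_snot, hΔ.has_snot, h Γ Δ hΓ hΔ hα]

/-- The basic formulas of `Γ` fix which `ML` formulas belong to a maximal consistent set, so they
derive `φ`. A derivation uses finitely many of them, and a conjunction of basic formulas is again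
basic. -/
theorem MLDetermined.exists_basic {l : Level} {φ : Fm l} (hφ : MLDetermined φ) {Γ : Set Formula}
    (hΓ : IsMCS Γ) (h : Has Γ φ) :
    ∃ α βs, Has Γ (basic α βs) ∧ ∀ Δ, IsMCS Δ → Has Δ (basic α βs) → Has Δ φ := by
  have hcl : MPClosure formulaImp teamThm
      {χ | ∃ α βs, Has Γ (basic α βs) ∧ χ = ⟨.team, basic α βs⟩} ⟨l, φ⟩ := by
    by_contra hn
    obtain ⟨Δ, hsub, hΔ, hnot⟩ := isClassical_team.exists_isMaxCons hn
    refine hnot ((hφ Γ Δ hΓ hΔ fun α => ⟨fun hα => ?_, fun hα => ?_⟩).1 h)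
    · exact (hΔ.has_basic.1 (hsub ⟨α, [], hΓ.has_basic.2 ⟨hα, by simp⟩, rfl⟩)).1
    · by_contra hα'
      -- Absence of `α` from `Γ` is recorded by the basic formula of `verum` and `[α]`.
      exact (hΔ.has_basic.1 (hsub ⟨verum, [α], hΓ.has_basic.2
        ⟨hΓ.has derives_verum, by simpa using hα'⟩, rfl⟩)).2 α (by simp) hα
  suffices ∀ χ : Formula, MPClosure formulaImp teamThm
      {χ | ∃ α βs, Has Γ (basic α βs) ∧ χ = ⟨.team, basic α βs⟩} χ →
      ∃ α βs, Has Γ (basic α βs) ∧ ∀ Δ, IsMCS Δ → Has Δ (basic α βs) → χ ∈ Δ from this _ hcl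
  clear hcl
  intro χ hcl
  induction hcl with
  | thm h =>
    exact ⟨verum, [], hΓ.has_basic.2 ⟨hΓ.has derives_verum, by simp⟩, fun Δ hΔ _ => hΔ.thm h⟩
  | prem h =>
    obtain ⟨α, βs, hb, rfl⟩ := h
    exact ⟨α, βs, hb, fun _ _ h => h⟩
  | mp _ _ h₁ h₂ =>
    obtain ⟨α, βs, hb, hall⟩ := h₁
    obtain ⟨α', βs', hb', hall'⟩ := h₂
    have key {Δ} (hΔ : IsMCS Δ) : Has Δ (basic (mand α α') (βs ++ βs')) ↔
        Has Δ (basic α βs) ∧ Has Δ (basic α' βs') := by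
      simp only [hΔ.has_basic, hΔ.has_mand, List.forall_mem_append]
      tauto
    exact ⟨mand α α', βs ++ βs', (key hΓ).2 ⟨hb, hb'⟩, fun Δ hΔ h =>
      hΔ.mp (hall Δ hΔ ((key hΔ).1 h).1) (hall' Δ hΔ ((key hΔ).1 h).2)⟩

/-- Replace first the right and then the left factor by a basic formula. The resulting tensor is a
condition on `ML` formulas, so it transfers to `Δ`, where the basic factors imply `ψ` and `φ`. -/
theorem MLDetermined.tensor {l m : Level} {φ : Fm l} {ψ : Fm m} (hφ : MLDetermined φ)
    (hψ : MLDetermined ψ) : MLDetermined (tensor φ ψ) := by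
  have key {Γ Δ} (hΓ : IsMCS Γ) (hΔ : IsMCS Δ) (hα : ∀ α : MLFormula, Has Γ α ↔ Has Δ α)
      (h : Has Γ (Fm.tensor φ ψ)) : Has Δ (Fm.tensor φ ψ) := by
    obtain ⟨Θ, hΘ, hψΘ, hall⟩ := hΓ.exists_of_tensor h
    obtain ⟨γ, γs, hγ, hγψ⟩ := hψ.exists_basic hΘ hψΘ
    obtain ⟨Ξ, hΞ, hφΞ, hall'⟩ := hΓ.exists_of_tensor (hΓ.tensor_comm (hall _ hγ))
    obtain ⟨β, βs, hβ, hβφ⟩ := hφ.exists_basic hΞ hφΞ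
    obtain ⟨h₁, h₂, h₃⟩ := hΓ.tensor_basic_left (hΓ.tensor_comm (hall' _ hβ))
    simp only [hα] at h₁ h₂ h₃
    exact hΔ.tensor_mono_left hβφ (hΔ.tensor_mono_right hγψ (hΔ.tensor_basic_right h₁ h₂ h₃))
  exact fun Γ Δ hΓ hΔ hα => ⟨key hΓ hΔ hα, key hΔ hΓ fun α => (hα α).symm⟩

/-- If `Γ` omits `Δφ`, it contains `◇` of a basic formula implying `∼φ`; this is a condition on `ML`
formulas and transfers. -/
theorem MLDetermined.delta {l : Level} {φ : Fm l} (hφ : MLDetermined φ) :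
    MLDetermined (delta φ) := by
  have key {Γ Δ} (hΓ : IsMCS Γ) (hΔ : IsMCS Δ) (hα : ∀ α : MLFormula, Has Γ α ↔ Has Δ α)
      (h : Has Δ (Fm.delta φ)) : Has Γ (Fm.delta φ) := by
    by_contra hn
    obtain ⟨Θ, hΘ, hφΘ, hall⟩ := hΓ.exists_of_not_delta hn
    obtain ⟨β, βs, hβ, hβφ⟩ := hφ.snot.exists_basic hΘ (hΘ.has_snot.2 hφΘ)
    have hd : Has Γ (diamond (basic β βs)) :=
      hΓ.has_diamond.2 fun h' => hΘ.has_snot.1 (hall _ h') hβ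
    obtain ⟨h₁, h₂⟩ := hΓ.diamond_basic_left hd
    simp only [hα] at h₁ h₂
    refine hΔ.has_diamond.1 (hΔ.diamond_basic_right h₁ h₂) (hΔ.has_delta_mono (fun Ξ hΞ h' => ?_) h)
    exact hΞ.has_snot.2 fun hb => hΞ.has_snot.1 (hβφ Ξ hΞ hb) h'
  exact fun Γ Δ hΓ hΔ hα => ⟨key hΔ hΓ fun α => (hα α).symm, key hΓ hΔ hα⟩

theorem mlDetermined {l : Level} (φ : Fm l) : MLDetermined φ := by
  induction φ with
  | var p => exact fun _ _ _ _ hα => hα _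
  | neg α => exact fun _ _ _ _ hα => hα _
  | imp α β => exact fun _ _ _ _ hα => hα _
  | box φ ih =>
    -- The preimages under `□` agree on `ML` because `□ α` is again an `ML` formula.
    exact fun Γ Δ hΓ hΔ hα => ih _ _ hΓ.preimage_box hΔ.preimage_box fun α => hα (box α)
  | snot φ ih => exact ih.snot
  | mimp φ ψ ih₁ ih₂ =>
    exact fun Γ Δ hΓ hΔ hα => by
      rw [hΓ.has_mimp, hΔ.has_mimp, ih₁ Γ Δ hΓ hΔ hα, ih₂ Γ Δ hΓ hΔ hα]
  | lin φ ψ ih₁ ih₂ =>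
    -- `φ ⊸ₗ ψ` amounts to `∼(φ ⊗ ∼ψ)`, which reduces the case to `⊗`.
    have lin_iff {Γ} (hΓ : IsMCS Γ) : Has Γ (φ ⊸ₗ ψ) ↔ ¬ Has Γ (tensor φ (∼ψ)) := by
      rw [hΓ.has_tensor, not_not]
      constructor <;> refine hΓ.has_lin_mono fun Δ hΔ => ?_ <;> simp [hΔ.has_snot]
    intro Γ Δ hΓ hΔ hα
    rw [lin_iff hΓ, lin_iff hΔ, ih₁.tensor ih₂.snot Γ Δ hΓ hΔ hα]
  | delta φ ih => exact ih.delta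

/-! ## The canonical structure -/

/-- The canonical Kripke structure. -/
def canonical : KripkeStructure.{u} where
  W := ULift {w : Set MLFormula // IsWorld w}
  R w v := ∀ α, box α ∈ w.down.1 → α ∈ v.down.1
  V p := {w | var p ∈ w.down.1}

theorem psat_canonical : (α : MLFormula) → (w : canonical.{u}.W) →
    (PSat canonical α w ↔ α ∈ w.down.1)
  | .var p, w => by
    simp only [PSat]
    exact Iff.rfl
  | .neg α, w => by
    simp only [PSat, w.down.2.neg_mem]
    exact not_congr (psat_canonical α w)
  | .imp α β, w => by
    simp only [PSat, w.down.2.imp_mem isClassical_ml]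
    exact imp_congr (psat_canonical α w) (psat_canonical β w)
  | .box α, w => by
    simp only [PSat]
    constructor
    · intro h
      by_contra hn
      obtain ⟨v, hv, hα, hall⟩ := isClassical_ml.exists_isMaxCons_of_normal (Γ := w.down.1) Fm.box
        (fun α hα => w.down.2.thm (.necBox hα))
        (fun α β h h' => w.down.2.mp h' (w.down.2.mp h (w.down.2.thm (.axH (.K α β))))) hn
      exact hα ((psat_canonical α ⟨v, hv⟩).1 (h ⟨v, hv⟩ hall))
    · exact fun h v hR => (psat_canonical α v).2 (hR α h)

/-- The team of a set of formulas in the canonical structure. -/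
def canonicalTeam (Γ : Set Formula) : Set canonical.{u}.W :=
  {w | ∀ α : MLFormula, Has Γ α → α ∈ w.down.1}

/-- The `ML` part of `Γ` is deductively closed, so by Lindenbaum's lemma each `ML` formula outside
it is missing from some world of the team. -/
theorem sat_canonicalTeam_ml {Γ : Set Formula} (hΓ : IsMCS Γ) (α : MLFormula) :
    Sat canonical.{u} α (canonicalTeam Γ) ↔ Has Γ α := by
  rw [sat_ml]
  constructor
  · intro h
    by_contra hn
    have hcl : ¬ MPClosure Fm.imp mlThm {α : MLFormula | Has Γ α} α := fun hd => hn <| by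
      clear h hn
      induction hd with
      | thm h => exact hΓ.has h
      | prem h => exact h
      | mp _ _ h₁ h₂ => exact hΓ.has_mp_ml h₂ h₁
    obtain ⟨w, hsub, hw, hα⟩ := isClassical_ml.exists_isMaxCons hcl
    exact hα ((psat_canonical α ⟨w, hw⟩).1 (h ⟨w, hw⟩ fun β hβ => hsub hβ))
  · exact fun h w hw => (psat_canonical α w).2 (hw α h)

/-- The formulas true in a team form a maximal consistent set. -/
theorem isMCS_theory (K : KripkeStructure.{u}) (T : Set K.W) :
    IsMCS {φ : Formula | Sat K φ.2 T} where
  thm h := Derives.sound h fun _ h => h.elim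
  mp {φ ψ} h h' := (sat_mimp K T φ.2 ψ.2).1 h' h
  neg_mem := sat_snot K T _

/-- The theory of the team and `Γ` are maximal consistent sets with the same `ML` formulas, hence
equal. -/
theorem sat_canonicalTeam {Γ : Set Formula} (hΓ : IsMCS Γ) (φ : Formula) :
    Sat canonical.{u} φ.2 (canonicalTeam Γ) ↔ φ ∈ Γ :=
  mlDetermined φ.2 _ Γ (isMCS_theory _ _) hΓ (sat_canonicalTeam_ml hΓ)

/-! ### Completeness and compactness -/

theorem closure_of_entails {Φ : Set Formula} {φ : Formula} (h : Entails.{u} Φ φ) :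
    MPClosure formulaImp teamThm Φ φ := by
  by_contra hn
  obtain ⟨Γ, hsub, hΓ, hφ⟩ := isClassical_team.exists_isMaxCons hn
  exact hφ ((sat_canonicalTeam hΓ φ).1
    (h canonical (canonicalTeam Γ) fun ψ hψ => (sat_canonicalTeam hΓ ψ).2 (hsub hψ)))

theorem entails_compact {Φ : Set Formula} {φ : Formula} (h : Entails.{u} Φ φ) :
    ∃ Φ₀ ⊆ Φ, Φ₀.Finite ∧ Entails.{u} Φ₀ φ := by
  obtain ⟨Φ₀, hsub, hfin, hd⟩ := (closure_of_entails h).exists_finite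
  exact ⟨Φ₀, hsub, hfin, fun K T hT => (derives_of_closure hd).sound hT⟩

theorem satisfiable_compact {Φ : Set Formula}
    (h : ∀ Φ₀ ⊆ Φ, Φ₀.Finite → Satisfiable.{u} Φ₀) : Satisfiable.{u} Φ := by
  by_contra hn
  -- An unsatisfiable `Φ` entails `∼verum`, which fails in every team, including the empty one.
  obtain ⟨Φ₀, hsub, hfin, hΦ₀⟩ := entails_compact (Φ := Φ) (φ := ⟨.team, ∼verum⟩)
    fun K T hT => (hn ⟨K, T, hT⟩).elim
  obtain ⟨K, T, hT⟩ := h Φ₀ hsub hfin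
  exact (sat_snot K T _).1 (hΦ₀ K T hT) (derives_verum.sound fun _ h => h.elim)

end MTL

/-- Soundness, completeness, and compactness (for entailment and for satisfiability). -/
theorem mainTheorem4 :
    (∀ (Φ : Set MTL.Formula) (φ : MTL.Formula),
      MTL.Derives Φ φ.2 → MTL.Entails.{u} Φ φ) ∧
    (∀ (Φ : Set MTL.Formula) (φ : MTL.Formula),
      MTL.Entails.{u} Φ φ → MTL.Derives Φ φ.2) ∧
    (∀ (Φ : Set MTL.Formula) (φ : MTL.Formula), MTL.Entails.{u} Φ φ →
      ∃ Φ₀ ⊆ Φ, Φ₀.Finite ∧ MTL.Entails.{u} Φ₀ φ) ∧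
    (∀ Φ : Set MTL.Formula,
      (∀ Φ₀ ⊆ Φ, Φ₀.Finite → MTL.Satisfiable.{u} Φ₀) → MTL.Satisfiable.{u} Φ) :=
  ⟨fun _ _ h _ _ hT => h.sound hT, fun _ _ h => MTL.derives_of_closure (MTL.closure_of_entails h),
    fun _ _ => MTL.entails_compact, fun _ => MTL.satisfiable_compact⟩
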